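/- Let $(M,\phi,\xi,\eta,g)$ be a $(2n+1)$-dimensional Kenmotsu manifold, i.e. $(M,g)$ is a smooth Riemannian manifold with a smooth $(1,1)$-tensor field $\phi$, a smooth vector field $\xi$ and a smooth $1$-form $\eta$ such that $$\phi^2=-I+\eta\otimes\xi,\quad \eta(\xi)=1,\quad \eta=g(\xi,\cdot),\quad g(\phi\cdot,\phi\cdot)=g-\eta\otimes\eta,$$ and such that the Levi-Civita connection $\nabla$ of $g$ satisfies $(\nabla_X\phi)Y=g(\phi X,Y)\xi-\eta(Y)\phi X$ for all vector fields $X,Y$. Let $a>0$ be a constant and let $$\overline g=a\,g+a(a-1)\,\eta\otimes\eta$$ be the metric of the $D$-homothetically deformed structure $(\overline\phi,\overline\xi,\overline\eta,\overline g)=(\phi,\tfrac1a\xi,a\eta,\overline g)$. Let $f,\overline\lambda\in C^\infty(M)$ and suppose that $V=\overline{\mathrm{grad}}(f)$, the gradient of $f$ with respect to $\overline g$, defines together with $\overline\lambda$ a gradient almost Riemann soliton on $(M,\overline g)$: $$\tfrac12\,(\mathcal L_V\overline g)\odot\overline g+\overline R=\overline\lambda\cdot\tfrac12\,\overline g\odot\overline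 g .$$ Here $\overline R(X,Y,Z,W)=\overline g(\overline R(X,Y)Z,W)$ with $\overline R(X,Y)=[\overline\nabla_X,\overline\nabla_Y]-\overline\nabla_{[X,Y]}$ is the Riemann curvature tensor of $\overline g$, and $$(T_1\odot T_2)(X,Y,Z,W)=T_1(X,W)T_2(Y,Z)+T_1(Y,Z)T_2(X,W)-T_1(X,Z)T_2(Y,W)-T_1(Y,W)T_2(X,Z).$$ Then, at every point of $M$, $$ \begin{aligned} |\mathrm{Ric}|_g^2\ \ge\ & (2n-1)^2|\mathrm{Hess}(f)|_g^2-4n\,\frac{a-1}{a}\,\mathrm{scal}-4n^2(2n+1)\Big(\frac{a-1}{a}\Big)^2\\ &-\frac{(2n-1)^2}{2n+1}(\Delta f)^2-\frac{2(2n-1)^2}{2n+1}\,\frac{a-1}{a}\,\big[\xi(f)-\xi(\xi(f))\big]\,\Delta f\\ &+\frac{2n(2n-1)^2}{2n+1}\Big(\frac{a-1}{a}\Big)^2(\xi(f))^2-\frac{2(2n-1)^2(n+na+a)(a-1)}{(2n+1)a^2}\,(\xi(\xi(f)))^2\\ &+\frac{2(2n-1)^2(2n+a)(a-1)}{(2n+1)a^2}\,\xi(f)\,\xi(\xi(f)),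 \end{aligned} $$ where $\mathrm{Ric}$, $\mathrm{scal}$, $\mathrm{Hess}(f)$ and $\Delta f=\mathrm{tr}_g\mathrm{Hess}(f)$ are the Ricci tensor, the scalar curvature, the Hessian and the Laplacian with respect to the original metric $g$, and $|T|_g^2=\sum_{i,j}T(E_i,E_j)^2$ (for any $g$-orthonormal frame $E_i$) is the squared Hilbert-Schmidt norm. -/

import Mathlib

open scoped Manifold ContDiff

noncomputable section

/-! ### Multilinear algebra of a metric `b` on a real vector space -/

section Algebra

variable {T : Type*} [AddCommGroup T] [Module ℝ T] [TopologicalSpace T]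
  [IsTopologicalAddGroup T] [ContinuousSMul ℝ T]
  {E : Type*} [NormedAddCommGroup E] [NormedSpace ℝ E]

/-- The musical isomorphism `T* → T` of a nondegenerate bilinear form `b`, i.e. the inverse of
`v ↦ b(v, ·)`. -/
def sharp (b : T →L[ℝ] T →L[ℝ] ℝ) : (T →L[ℝ] ℝ) →L[ℝ] T := b.inverse

/-- The trace of a `(0,2)`-tensor with respect to `b`; this is `∑ i, A(e_i, e_i)` for every
`b`-orthonormal basis `e`. -/
def metricTrace (b A : E →L[ℝ] E →L[ℝ] ℝ) : ℝ :=
  LinearMap.trace ℝ E (sharp b ∘L A).toLinearMap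

/-- The squared Hilbert-Schmidt norm of a `(0,2)`-tensor with respect to `b`, as the full
contraction `b^{ik} b^{jl} A_{ij} A_{kl}`; this is `∑ i j, A(e_i, e_j) ^ 2` for every
`b`-orthonormal basis `e`. -/
def hilbertSchmidtSq (b A : E →L[ℝ] E →L[ℝ] ℝ) : ℝ :=
  LinearMap.trace ℝ E (sharp b ∘L A ∘L sharp b ∘L A.flip).toLinearMap

/-- The Kulkarni-Nomizu product of two `(0,2)`-tensors. -/
def kulkarniNomizu (A B : E →L[ℝ] E →L[ℝ] ℝ) (X Y Z W : E) : ℝ :=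
  A X W * B Y Z + A Y Z * B X W - A X Z * B Y W - A Y W * B X Z

end Algebra

/-! ### Riemannian geometry in a coordinate domain

`G y` is the matrix of the metric at the point `y` of the vector space `E` of coordinates. -/

namespace Coord

variable {E : Type*} [NormedAddCommGroup E] [NormedSpace ℝ E]

/-- Christoffel symbols `Γ(u, v) = Γ^k_{ij} u^i v^j ∂_k` of the Levi-Civita connection of `G`:
`G(Γ(u, v), w) = (1/2) (∂_u G(v, w) + ∂_v G(u, w) - ∂_w G(u, v))`. -/
def christoffel (G : E → E →L[ℝ] E →L[ℝ] ℝ) (y : E) : E →L[ℝ] E →L[ℝ] E :=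
  let S := ContinuousLinearMap.compL ℝ E (E →L[ℝ] ℝ) E (sharp (G y))
  let D := fderiv ℝ G y
  let D' := (ContinuousLinearMap.flipₗᵢ ℝ E E ℝ).toContinuousLinearEquiv.toContinuousLinearMap ∘L
    D.flip
  (1 / 2 : ℝ) • (S ∘L D + S ∘L D.flip - S ∘L D')

/-- `(∇_u Φ) v` for the Levi-Civita connection of `G` and a `(1,1)`-tensor field `Φ`. -/
def covDerivEndo (G : E → E →L[ℝ] E →L[ℝ] ℝ) (Φ : E → E →L[ℝ] E) (y u v : E) : E :=
  fderiv ℝ Φ y u v + christoffel G y u (Φ y v) - Φ y (christoffel G y u v)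

/-- The Riemann curvature `u ↦ R(u, v) w`, where
`R(U, V) W = ∇_U ∇_V W - ∇_V ∇_U W - ∇_{[U, V]} W`. -/
def curvature (G : E → E →L[ℝ] E →L[ℝ] ℝ) (y v w : E) : E →ₗ[ℝ] E where
  toFun u := fderiv ℝ (christoffel G) y u v w - fderiv ℝ (christoffel G) y v u w
    + christoffel G y u (christoffel G y v w) - christoffel G y v (christoffel G y u w)
  map_add' u u' := by simp; abel
  map_smul' r u := by simp [smul_sub, smul_add]

/-- The Riemann curvature tensor of type `(0,4)`, `R(X, Y, Z, W) = G(R(X, Y) Z, W)`. -/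
def riemann (G : E → E →L[ℝ] E →L[ℝ] ℝ) (y X Y Z W : E) : ℝ :=
  G y (curvature G y Y Z X) W

/-- The Ricci tensor `Ric(v, w) = trace (u ↦ R(u, v) w)`. -/
def ricci [FiniteDimensional ℝ E] (G : E → E →L[ℝ] E →L[ℝ] ℝ) (y : E) : E →L[ℝ] E →L[ℝ] ℝ :=
  LinearMap.toContinuousBilinearMap <| LinearMap.mk₂ ℝ
    (fun v w ↦ LinearMap.trace ℝ E (curvature G y v w))
    (fun v v' w ↦ by
      rw [← map_add]; congr 1; ext u; simp [curvature]; abel)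
    (fun r v w ↦ by
      rw [← map_smul]; congr 1; ext u; simp [curvature, smul_sub, smul_add])
    (fun v w w' ↦ by
      rw [← map_add]; congr 1; ext u; simp [curvature]; abel)
    (fun r v w ↦ by
      rw [← map_smul]; congr 1; ext u; simp [curvature, smul_sub, smul_add])

/-- The Hessian `∂_u ∂_v F - dF(Γ(u, v))` of a function `F`. -/
def hessian (G : E → E →L[ℝ] E →L[ℝ] ℝ) (F : E → ℝ) (y : E) : E →L[ℝ] E →L[ℝ] ℝ :=
  fderiv ℝ (fderiv ℝ F) y -
    ContinuousLinearMap.compL ℝ E E ℝ (fderiv ℝ F y) ∘L christoffel G y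

/-- The Lie derivative `L_V G = V^k ∂_k G_{ij} + G_{kj} ∂_i V^k + G_{ik} ∂_j V^k`. -/
def lieDerivMetric (G : E → E →L[ℝ] E →L[ℝ] ℝ) (V : E → E) (y : E) : E →L[ℝ] E →L[ℝ] ℝ :=
  fderiv ℝ G y (V y) + G y ∘L fderiv ℝ V y + ((G y).flip ∘L fderiv ℝ V y).flip

end Coord

/-! ### Tensor fields on a manifold, read in a chart -/

section Manifold

variable {E : Type*} [NormedAddCommGroup E] [NormedSpace ℝ E]
  {M : Type*} [TopologicalSpace M] [ChartedSpace E M]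

/-- The differential `T_x M → E` of a chart. -/
def chartDeriv (c : OpenPartialHomeomorph M E) (x : M) : TangentSpace 𝓘(ℝ, E) x →L[ℝ] E :=
  mfderiv 𝓘(ℝ, E) 𝓘(ℝ, E) c x

/-- The differential `E → T_x M` of the inverse of a chart, where `x = c⁻¹(y)`. -/
def chartSymmDeriv (c : OpenPartialHomeomorph M E) (y : E) :
    E →L[ℝ] TangentSpace 𝓘(ℝ, E) (c.symm y) :=
  mfderiv 𝓘(ℝ, E) 𝓘(ℝ, E) c.symm y

/-- A vector field in the chart `c`. -/
def fieldIn (c : OpenPartialHomeomorph M E) (X : Π x : M, TangentSpace 𝓘(ℝ, E) x) (y : E) : E :=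
  chartDeriv c (c.symm y) (X (c.symm y))

/-- A `1`-form in the chart `c`. -/
def formIn (c : OpenPartialHomeomorph M E) (α : Π x : M, TangentSpace 𝓘(ℝ, E) x →L[ℝ] ℝ) (y : E) :
    E →L[ℝ] ℝ :=
  α (c.symm y) ∘L chartSymmDeriv c y

/-- A `(1,1)`-tensor field in the chart `c`. -/
def endoIn (c : OpenPartialHomeomorph M E)
    (Φ : Π x : M, TangentSpace 𝓘(ℝ, E) x →L[ℝ] TangentSpace 𝓘(ℝ, E) x) (y : E) : E →L[ℝ] E :=
  chartDeriv c (c.symm y) ∘L Φ (c.symm y) ∘L chartSymmDeriv c y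

/-- A `(0,2)`-tensor field in the chart `c`. -/
def bilinIn (c : OpenPartialHomeomorph M E)
    (A : Π x : M, TangentSpace 𝓘(ℝ, E) x →L[ℝ] TangentSpace 𝓘(ℝ, E) x →L[ℝ] ℝ) (y : E) :
    E →L[ℝ] E →L[ℝ] ℝ :=
  (chartSymmDeriv c y).precomp ℝ ∘L A (c.symm y) ∘L chartSymmDeriv c y

/-! ### Riemannian geometry on a manifold

Identities between tensors are read in all charts. The scalars below are computed in the preferred
chart at each point; being full contractions of tensors, they do not depend on the chart. -/

/-- The directional derivative `X(f)`. -/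
def dirDeriv (X : Π x : M, TangentSpace 𝓘(ℝ, E) x) (f : M → ℝ) (p : M) : ℝ :=
  mfderiv 𝓘(ℝ, E) 𝓘(ℝ, ℝ) f p (X p)

/-- The gradient of `f` with respect to `g`. -/
def grad (g : Π x : M, TangentSpace 𝓘(ℝ, E) x →L[ℝ] TangentSpace 𝓘(ℝ, E) x →L[ℝ] ℝ)
    (f : M → ℝ) (p : M) : TangentSpace 𝓘(ℝ, E) p :=
  sharp (g p) (mfderiv 𝓘(ℝ, E) 𝓘(ℝ, ℝ) f p)

/-- The scalar curvature of `g`, the trace of the Ricci tensor. -/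
def scal [FiniteDimensional ℝ E]
    (g : Π x : M, TangentSpace 𝓘(ℝ, E) x →L[ℝ] TangentSpace 𝓘(ℝ, E) x →L[ℝ] ℝ) (p : M) : ℝ :=
  let c := chartAt E p
  metricTrace (bilinIn c g (c p)) (Coord.ricci (bilinIn c g) (c p))

/-- The squared norm `|Ric|²` of the Ricci tensor of `g` with respect to `g`. -/
def ricciNormSq [FiniteDimensional ℝ E]
    (g : Π x : M, TangentSpace 𝓘(ℝ, E) x →L[ℝ] TangentSpace 𝓘(ℝ, E) x →L[ℝ] ℝ) (p : M) : ℝ :=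
  let c := chartAt E p
  hilbertSchmidtSq (bilinIn c g (c p)) (Coord.ricci (bilinIn c g) (c p))

/-- The Laplacian of `f` with respect to `g`, the trace of the Hessian. -/
def laplacian (g : Π x : M, TangentSpace 𝓘(ℝ, E) x →L[ℝ] TangentSpace 𝓘(ℝ, E) x →L[ℝ] ℝ)
    (f : M → ℝ) (p : M) : ℝ :=
  let c := chartAt E p
  metricTrace (bilinIn c g (c p)) (Coord.hessian (bilinIn c g) (f ∘ c.symm) (c p))

/-- The squared norm `|Hess f|²` of the Hessian of `f` with respect to `g`. -/
def hessNormSq (g : Π x : M, TangentSpace 𝓘(ℝ, E) x →L[ℝ] TangentSpace 𝓘(ℝ, E) x →L[ℝ] ℝ)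
    (f : M → ℝ) (p : M) : ℝ :=
  let c := chartAt E p
  hilbertSchmidtSq (bilinIn c g (c p)) (Coord.hessian (bilinIn c g) (f ∘ c.symm) (c p))

/-- `(V, lam)` defines an almost Riemann soliton for the metric `g`: `lam` is a smooth function and
`(1/2) L_V g ⊙ g + R = lam G` with `G = (1/2) g ⊙ g`. Zeros of `V` are allowed. -/
structure IsAlmostRiemannSoliton [IsManifold 𝓘(ℝ, E) ∞ M]
    (g : Π x : M, TangentSpace 𝓘(ℝ, E) x →L[ℝ] TangentSpace 𝓘(ℝ, E) x →L[ℝ] ℝ)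
    (V : Π x : M, TangentSpace 𝓘(ℝ, E) x) (lam : M → ℝ) : Prop where
  smooth_field : ContMDiff 𝓘(ℝ, E) (𝓘(ℝ, E).prod 𝓘(ℝ, E)) ∞
    (fun x ↦ Bundle.TotalSpace.mk' E (E := fun x : M ↦ TangentSpace 𝓘(ℝ, E) x) x (V x))
  smooth_lam : ContMDiff 𝓘(ℝ, E) 𝓘(ℝ, ℝ) ∞ lam
  equation : ∀ c ∈ atlas E M, ∀ y ∈ c.target, ∀ X Y Z W : E,
    (1 / 2) * kulkarniNomizu (Coord.lieDerivMetric (bilinIn c g) (fieldIn c V) y)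
        (bilinIn c g y) X Y Z W
      + Coord.riemann (bilinIn c g) y X Y Z W =
    lam (c.symm y) * ((1 / 2) * kulkarniNomizu (bilinIn c g y) (bilinIn c g y) X Y Z W)

/-! ### Almost contact metric structures -/

variable (E M) in
/-- A (smooth) almost contact metric structure `(φ, ξ, η, g)` on the manifold `M`. -/
structure AlmostContactMetricStructure [IsManifold 𝓘(ℝ, E) ∞ M] where
  /-- the Riemannian metric -/
  metric : Bundle.ContMDiffRiemannianMetric 𝓘(ℝ, E) ∞ E
    (fun x : M ↦ TangentSpace 𝓘(ℝ, E) x)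
  /-- the `(1,1)`-tensor field -/
  φ : Π x : M, TangentSpace 𝓘(ℝ, E) x →L[ℝ] TangentSpace 𝓘(ℝ, E) x
  /-- the Reeb vector field -/
  ξ : Π x : M, TangentSpace 𝓘(ℝ, E) x
  /-- the `1`-form -/
  η : Π x : M, TangentSpace 𝓘(ℝ, E) x →L[ℝ] ℝ
  contMDiff_φ : ContMDiff 𝓘(ℝ, E) (𝓘(ℝ, E).prod 𝓘(ℝ, E →L[ℝ] E)) ∞
    (fun x ↦ Bundle.TotalSpace.mk' (E →L[ℝ] E)
      (E := fun x : M ↦ TangentSpace 𝓘(ℝ, E) x →L[ℝ] TangentSpace 𝓘(ℝ, E) x) x (φ x))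
  contMDiff_ξ : ContMDiff 𝓘(ℝ, E) (𝓘(ℝ, E).prod 𝓘(ℝ, E)) ∞
    (fun x ↦ Bundle.TotalSpace.mk' E (E := fun x : M ↦ TangentSpace 𝓘(ℝ, E) x) x (ξ x))
  contMDiff_η : ContMDiff 𝓘(ℝ, E) (𝓘(ℝ, E).prod 𝓘(ℝ, E →L[ℝ] ℝ)) ∞
    (fun x ↦ Bundle.TotalSpace.mk' (E →L[ℝ] ℝ)
      (E := fun x : M ↦ TangentSpace 𝓘(ℝ, E) x →L[ℝ] Bundle.Trivial M ℝ x) x (η x))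
  φ_φ : ∀ x v, φ x (φ x v) = -v + η x v • ξ x
  η_ξ : ∀ x, η x (ξ x) = 1
  η_eq : ∀ x v, η x v = metric.inner x (ξ x) v
  metric_φ_φ : ∀ x v w, metric.inner x (φ x v) (φ x w) = metric.inner x v w - η x v * η x w

namespace AlmostContactMetricStructure

variable [IsManifold 𝓘(ℝ, E) ∞ M] (S : AlmostContactMetricStructure E M)

/-- The metric `g`, as a `(0,2)`-tensor field. -/
def g (x : M) : TangentSpace 𝓘(ℝ, E) x →L[ℝ] TangentSpace 𝓘(ℝ, E) x →L[ℝ] ℝ := S.metric.inner x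

/-- The Kenmotsu condition `(∇_X φ) Y = g(φ X, Y) ξ - η(Y) φ X`, read in every chart. -/
def IsKenmotsu : Prop :=
  ∀ c ∈ atlas E M, ∀ y ∈ c.target, ∀ u v : E,
    Coord.covDerivEndo (bilinIn c S.g) (endoIn c S.φ) y u v =
      bilinIn c S.g y (endoIn c S.φ y u) v • fieldIn c S.ξ y -
        formIn c S.η y v • endoIn c S.φ y u

/-- The metric `a g + a (a - 1) η ⊗ η` of the `D`-homothetic deformation with constant `a`. -/
def deformedMetric (a : ℝ) (x : M) :
    TangentSpace 𝓘(ℝ, E) x →L[ℝ] TangentSpace 𝓘(ℝ, E) x →L[ℝ] ℝ :=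
  a • S.g x + (a * (a - 1)) • (S.η x).smulRight (S.η x)

end AlmostContactMetricStructure

end Manifold

end

/-! Write k = (a-1)/a and let T = Ric + 2nk g. The terms of the bound in scal and in k² alone
complete |Ric|² to |T|². The rest of the bound is exactly |T₀|², where T₀ is the trace-free part of
T, so the inequality is |T|² ≥ |T₀|² and the gap is (tr T)²/(2n+1).

The Kenmotsu condition forces ∇ξ = I - η⊗ξ (`fderiv_field`). Hence η is closed, Ric(ξ,ξ) = -2n, and
Hess f(ξ,ξ) = ξ(ξ(f)) because ∇_ξ ξ = 0. The deformed connection differs from ∇ by the tensor k(g -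
η⊗η)ξ (`christoffel_deform`), which makes the change in Ric and Hess explicit.

For a gradient field the soliton equation involves the deformed Hessian, and contracting it makes
the deformed Ricci tensor a combination of this Hessian and the deformed metric
(`IsMetricOn.exists_ricci_eq`). In terms of g this reads Ric = -(2n-1) Hess f + α g + β η⊗η with one
unknown scalar s, which also absorbs the soliton function. Evaluation at (ξ,ξ) determines s and
gives β = -(2n-1)k(ξ(f) - ξ(ξ(f))). Norm and trace are then expanded
(`hilbertSchmidtSq_combination`, `metricTrace_combination`) and compared in `scalar_identity`. -/

set_option linter.unusedSectionVars false

/-! ### Traces and norms with respect to a positive definite form -/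

section MetricAlgebra

variable {E : Type*} [NormedAddCommGroup E] [NormedSpace ℝ E] [FiniteDimensional ℝ E]
  {b : E →L[ℝ] E →L[ℝ] ℝ}

/-- A positive definite form, as an isomorphism from the space to its dual. -/
theorem exists_equiv_of_pos (hb : ∀ u, u ≠ 0 → 0 < b u u) :
    ∃ e : E ≃L[ℝ] (E →L[ℝ] ℝ), (e : E →L[ℝ] E →L[ℝ] ℝ) = b := by
  have hinj : Function.Injective (b : E →ₗ[ℝ] E →L[ℝ] ℝ) := by
    refine (injective_iff_map_eq_zero _).2 fun u hu ↦ ?_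
    by_contra h
    have h1 := hb u h
    have h2 : b u = 0 := hu
    simp [h2] at h1
  have hdim : Module.finrank ℝ E = Module.finrank ℝ (E →L[ℝ] ℝ) := by
    rw [← (LinearMap.toContinuousLinearMap (𝕜 := ℝ) (E := E) (F' := ℝ)).finrank_eq]
    exact Subspace.dual_finrank_eq.symm
  refine ⟨((b : E →ₗ[ℝ] E →L[ℝ] ℝ).linearEquivOfInjective hinj hdim).toContinuousLinearEquiv, ?_⟩
  ext u v
  rfl

/-- `sharp` is built on `ContinuousLinearMap.inverse`, which is a true inverse only at invertible
maps and zero elsewhere. Positivity in finite dimension supplies the invertibility. -/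
theorem sharp_apply_self (hb : ∀ u, u ≠ 0 → 0 < b u u) (u : E) : sharp b (b u) = u := by
  obtain ⟨e, rfl⟩ := exists_equiv_of_pos hb
  simp [sharp]

theorem apply_sharp (hb : ∀ u, u ≠ 0 → 0 < b u u) (α : E →L[ℝ] ℝ) : b (sharp b α) = α := by
  obtain ⟨e, rfl⟩ := exists_equiv_of_pos hb
  simp [sharp]

theorem eq_of_forall_apply_eq (hb : ∀ u, u ≠ 0 → 0 < b u u) {u v : E}
    (h : ∀ w, b u w = b v w) : u = v := by
  rw [← sharp_apply_self hb u, ← sharp_apply_self hb v, ContinuousLinearMap.ext h]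

/-- The Hilbert-Schmidt norm and the trace of a combination of a symmetric tensor, the metric and
the square of a unit covector. -/
theorem hilbertSchmidtSq_combination (hb : ∀ u, u ≠ 0 → 0 < b u u) (hs : ∀ u v, b u v = b v u)
    {H : E →L[ℝ] E →L[ℝ] ℝ} (hH : ∀ u v, H u v = H v u) {ξ : E} (hξ : b ξ ξ = 1) (x y z : ℝ) :
    hilbertSchmidtSq b (x • H + y • b + z • (b ξ).smulRight (b ξ)) =
      x ^ 2 * hilbertSchmidtSq b H + 2 * x * y * metricTrace b H + 2 * x * z * H ξ ξ
        + y ^ 2 * Module.finrank ℝ E + 2 * y * z + z ^ 2 := by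
  set h : E →ₗ[ℝ] E := (sharp b ∘L H).toLinearMap with hh
  -- The square of the unit covector, with an index raised, is the orthogonal projection onto the
  -- line of ξ: idempotent of trace 1.
  set q : E →ₗ[ℝ] E := (b ξ).toLinearMap.smulRight ξ with hq
  have hflip : ∀ A : E →L[ℝ] E →L[ℝ] ℝ, (∀ u v, A u v = A v u) → A.flip = A := fun A hA ↦ by
    ext u v; simpa using hA v u
  have e1 : hilbertSchmidtSq b H = LinearMap.trace ℝ E (h * h) := by
    rw [hilbertSchmidtSq, hflip H hH]; rfl
  have e2 : hilbertSchmidtSq b (x • H + y • b + z • (b ξ).smulRight (b ξ)) =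
      LinearMap.trace ℝ E ((x • h + y • 1 + z • q) * (x • h + y • 1 + z • q)) := by
    have hk : (sharp b ∘L (x • H + y • b + z • (b ξ).smulRight (b ξ))).toLinearMap =
        x • h + y • 1 + z • q := by
      ext u
      simp [hh, hq, sharp_apply_self hb]
    rw [hilbertSchmidtSq, hflip _ (fun u v ↦ by
      simp only [add_apply, smul_apply, ContinuousLinearMap.smulRight_apply, smul_eq_mul, hH u v,
        hs u v]
      ring), ← hk]
    rfl
  have t1 : LinearMap.trace ℝ E (h * q) = H ξ ξ := by
    have : h * q = (b ξ).toLinearMap.smulRight (h ξ) := by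
      ext u; simp [hq]
    rw [this, LinearMap.trace_smulRight]
    change b ξ (sharp b (H ξ)) = _
    rw [hs, apply_sharp hb]
  have t2 : LinearMap.trace ℝ E (q * h) = H ξ ξ := by rw [LinearMap.trace_mul_comm, t1]
  have t3 : LinearMap.trace ℝ E (q * q) = 1 := by
    have : q * q = q := by
      ext u; simp [hq, hξ]
    rw [this, LinearMap.trace_smulRight]; exact hξ
  have t4 : LinearMap.trace ℝ E q = 1 := by rw [LinearMap.trace_smulRight]; exact hξ
  rw [e2, e1]
  simp only [add_mul, mul_add, smul_mul_smul_comm, one_mul, mul_one, map_add, map_smul, t1, t2, t3,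
    t4, LinearMap.trace_one, smul_eq_mul, ← show metricTrace b H = LinearMap.trace ℝ E h from rfl]
  ring

theorem metricTrace_combination (hb : ∀ u, u ≠ 0 → 0 < b u u)
    (H : E →L[ℝ] E →L[ℝ] ℝ) {ξ : E} (hξ : b ξ ξ = 1) (x y z : ℝ) :
    metricTrace b (x • H + y • b + z • (b ξ).smulRight (b ξ)) =
      x * metricTrace b H + y * Module.finrank ℝ E + z := by
  have hk : (sharp b ∘L (x • H + y • b + z • (b ξ).smulRight (b ξ))).toLinearMap =
      x • (sharp b ∘L H).toLinearMap + y • 1 + z • (b ξ).toLinearMap.smulRight ξ := by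
    ext u
    simp [sharp_apply_self hb]
  rw [metricTrace, hk, map_add, map_add, map_smul, map_smul, map_smul, LinearMap.trace_smulRight,
    LinearMap.trace_one]
  simp [hξ, metricTrace]

end MetricAlgebra

/-! ### The Levi-Civita connection and the contracted soliton equation in coordinates -/

namespace Coord

variable {E : Type*} [NormedAddCommGroup E] [NormedSpace ℝ E] [FiniteDimensional ℝ E]

/-- `G` is a smooth Riemannian metric on the open set `U`. -/
structure IsMetricOn (U : Set E) (G : E → E →L[ℝ] E →L[ℝ] ℝ) : Prop where
  isOpen : IsOpen U
  contDiffOn : ContDiffOn ℝ ∞ G U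
  symm : ∀ y ∈ U, ∀ u v, G y u v = G y v u
  pos : ∀ y ∈ U, ∀ u, u ≠ 0 → 0 < G y u u

section Metric

variable {U : Set E} {G : E → E →L[ℝ] E →L[ℝ] ℝ} {y : E}

theorem fderiv_apply_eq {F : Type*} [NormedAddCommGroup F] [NormedSpace ℝ F] {A : E → E →L[ℝ] F}
    {V : E → E} (hA : DifferentiableAt ℝ A y) (hV : DifferentiableAt ℝ V y) (u : E) :
    fderiv ℝ (fun y ↦ A y (V y)) y u = fderiv ℝ A y u (V y) + A y (fderiv ℝ V y u) := by
  rw [fderiv_clm_apply hA hV]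
  simp [add_comm]

theorem fderiv_apply_apply_eq {F : Type*} [NormedAddCommGroup F] [NormedSpace ℝ F]
    {A : E → E →L[ℝ] E →L[ℝ] F} (hA : DifferentiableAt ℝ A y) (u v w : E) :
    fderiv ℝ (fun y ↦ A y v w) y u = fderiv ℝ A y u v w := by
  rw [fderiv_apply_eq (A := fun y ↦ A y v) (by fun_prop) (by fun_prop),
    fderiv_apply_eq hA (by fun_prop)]
  simp

theorem IsMetricOn.contDiffAt (hG : IsMetricOn U G) (hy : y ∈ U) : ContDiffAt ℝ ∞ G y :=
  hG.contDiffOn.contDiffAt (hG.isOpen.mem_nhds hy)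

theorem IsMetricOn.differentiableAt (hG : IsMetricOn U G) (hy : y ∈ U) :
    DifferentiableAt ℝ G y :=
  (hG.contDiffAt hy).differentiableAt (by simp)

theorem IsMetricOn.fderiv_symm (hG : IsMetricOn U G) (hy : y ∈ U) (u v w : E) :
    fderiv ℝ G y u v w = fderiv ℝ G y u w v := by
  rw [← fderiv_apply_apply_eq (hG.differentiableAt hy),
    ← fderiv_apply_apply_eq (hG.differentiableAt hy)]
  congr 1
  refine Filter.EventuallyEq.fderiv_eq ?_
  filter_upwards [hG.isOpen.mem_nhds hy] with z hz using hG.symm z hz v w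

/-- The Koszul formula for constant coordinate fields. Together with `eq_of_forall_apply_eq` it lets
Christoffel symbols be identified without inverting the metric. -/
theorem IsMetricOn.apply_christoffel (hG : IsMetricOn U G) (hy : y ∈ U) (u v w : E) :
    G y (christoffel G y u v) w =
      (1 / 2) * (fderiv ℝ G y u v w + fderiv ℝ G y v u w - fderiv ℝ G y w u v) := by
  simp [christoffel, apply_sharp (hG.pos y hy), ContinuousLinearMap.compL_apply]

theorem IsMetricOn.christoffel_symm (hG : IsMetricOn U G) (hy : y ∈ U) (u v : E) :
    christoffel G y u v = christoffel G y v u := by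
  refine eq_of_forall_apply_eq (hG.pos y hy) fun w ↦ ?_
  rw [hG.apply_christoffel hy, hG.apply_christoffel hy, hG.fderiv_symm hy w u v]
  ring

/-- The Levi-Civita connection is metric. -/
theorem IsMetricOn.fderiv_eq (hG : IsMetricOn U G) (hy : y ∈ U) (u v w : E) :
    fderiv ℝ G y u v w = G y (christoffel G y u v) w + G y v (christoffel G y u w) := by
  rw [hG.symm y hy v, hG.apply_christoffel hy, hG.apply_christoffel hy, hG.fderiv_symm hy u w v,
    hG.fderiv_symm hy v u w]
  ring

-- Inversion of operators is smooth at invertible ones, so the inverse metric is as smooth as the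
-- metric; the symbols combine it with the differentiable first derivative of `G`.
set_option maxSynthPendingDepth 5 in
theorem IsMetricOn.differentiableAt_christoffel (hG : IsMetricOn U G) (hy : y ∈ U) :
    DifferentiableAt ℝ (christoffel G) y := by
  have h0 : ContDiffAt ℝ ∞ (fun y ↦ sharp (G y)) y := by
    obtain ⟨e, he⟩ := exists_equiv_of_pos (hG.pos y hy)
    have : ContDiffAt ℝ ∞ (ContinuousLinearMap.inverse (M := E) (M₂ := E →L[ℝ] ℝ) (R := ℝ)) (G y) := by
      rw [← he]; exact contDiffAt_map_inverse e
    exact this.comp y (hG.contDiffAt hy)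
  have h1 : DifferentiableAt ℝ (fun y ↦ sharp (G y)) y := h0.differentiableAt (by simp)
  have h2 : DifferentiableAt ℝ (fderiv ℝ G) y :=
    ((hG.contDiffAt hy).fderiv_right (m := 1) (by norm_num; exact ENat.LEInfty.out)).differentiableAt (by simp)
  have h3 : DifferentiableAt ℝ (fun y ↦ (fderiv ℝ G y).flip) y :=
    (ContinuousLinearMap.flipₗᵢ ℝ E E (E →L[ℝ] ℝ)).differentiableAt.comp y h2
  have hS : DifferentiableAt ℝ
      (fun y ↦ ContinuousLinearMap.compL ℝ E (E →L[ℝ] ℝ) E (sharp (G y))) y :=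
    (ContinuousLinearMap.compL ℝ E (E →L[ℝ] ℝ) E).differentiableAt.comp y h1
  exact (((hS.clm_comp h2).add (hS.clm_comp h3)).sub
    (hS.clm_comp ((differentiableAt_const _).clm_comp h3))).const_smul (1 / 2 : ℝ)

/-- For a gradient field `V`, the Lie derivative of the metric is twice the Hessian. -/
theorem IsMetricOn.lieDerivMetric_eq (hG : IsMetricOn U G) (hy : y ∈ U) {V : E → E} {F : E → ℝ}
    (hV : DifferentiableAt ℝ V y) (hF : ContDiffAt ℝ ∞ F y)
    (hVF : ∀ z ∈ U, G z (V z) = fderiv ℝ F z) :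
    lieDerivMetric G V y = (2 : ℝ) • hessian G F y := by
  have hF2 : IsSymmSndFDerivAt ℝ F y := hF.isSymmSndFDerivAt (by simp; exact ENat.LEInfty.out)
  -- Differentiating dF = G(V, ·). The sum of this identity for (u, w) and for (w, u) yields the
  -- derivative terms of the Lie derivative.
  have hd : ∀ u w, fderiv ℝ (fderiv ℝ F) y u w = fderiv ℝ G y u (V y) w + G y (fderiv ℝ V y u) w := by
    intro u w
    rw [← add_apply, ← fderiv_apply_eq (hG.differentiableAt hy) hV]
    have : fderiv ℝ F =ᶠ[nhds y] fun z ↦ G z (V z) := by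
      filter_upwards [hG.isOpen.mem_nhds hy] with z hz using (hVF z hz).symm
    rw [this.fderiv_eq]
  ext u w
  have h1 := hd u w
  have h2 := hd w u
  rw [hF2.eq w u] at h2
  have h3 : fderiv ℝ F y (christoffel G y u w) =
      (1 / 2) * (fderiv ℝ G y u w (V y) + fderiv ℝ G y w u (V y) - fderiv ℝ G y (V y) u w) := by
    rw [← hVF y hy, hG.symm y hy, hG.apply_christoffel hy]
  have h4 := hG.fderiv_symm hy u w (V y)
  have h5 := hG.fderiv_symm hy w u (V y)
  simp only [lieDerivMetric, hessian, add_apply, ContinuousLinearMap.comp_apply,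
    ContinuousLinearMap.flip_apply, smul_apply, sub_apply, ContinuousLinearMap.compL_apply,
    smul_eq_mul, h3]
  rw [hG.symm y hy u]
  linear_combination -h1 - h2 + h4 + h5

theorem IsMetricOn.hessian_symm (hG : IsMetricOn U G) (hy : y ∈ U) {F : E → ℝ}
    (hF : ContDiffAt ℝ ∞ F y) (u v : E) : hessian G F y u v = hessian G F y v u := by
  have hF2 : IsSymmSndFDerivAt ℝ F y := hF.isSymmSndFDerivAt (by simp; exact ENat.LEInfty.out)
  simp [hessian, hF2.eq u v, hG.christoffel_symm hy u v]

theorem ricci_apply (G : E → E →L[ℝ] E →L[ℝ] ℝ) (y v w : E) :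
    ricci G y v w = LinearMap.trace ℝ E (curvature G y v w) := rfl

theorem curvature_apply (G : E → E →L[ℝ] E →L[ℝ] ℝ) (y u v w : E) :
    curvature G y v w u = fderiv ℝ (christoffel G) y u v w - fderiv ℝ (christoffel G) y v u w
      + christoffel G y u (christoffel G y v w) - christoffel G y v (christoffel G y u w) := rfl

/-- Contraction of the almost Riemann soliton equation. -/
theorem IsMetricOn.exists_ricci_eq (hG : IsMetricOn U G) (hy : y ∈ U) {T : E →L[ℝ] E →L[ℝ] ℝ}
    {l : ℝ}
    (h : ∀ X Y Z W, kulkarniNomizu T (G y) X Y Z W + riemann G y X Y Z W =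
      l * ((1 / 2) * kulkarniNomizu (G y) (G y) X Y Z W)) :
    ∃ s : ℝ, ricci G y = -(((Module.finrank ℝ E : ℝ) - 2) • T + s • G y) := by
  refine ⟨metricTrace (G y) T - l * (Module.finrank ℝ E - 1), ?_⟩
  ext Y Z
  -- The equation is solved for X ↦ R(X, Y)Z by raising the index W; its trace is then read off from
  -- multiples of the identity, the raised T and rank-one maps.
  have key : curvature G y Y Z = (l * G y Y Z - T Y Z) • (1 : E →ₗ[ℝ] E)
      - (G y Y Z) • (sharp (G y) ∘L T).toLinearMap
      + ((T.flip Z) : E →ₗ[ℝ] ℝ).smulRight Y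
      + (((G y).flip Z) : E →ₗ[ℝ] ℝ).smulRight (sharp (G y) (T Y) - l • Y) := by
    ext X
    refine eq_of_forall_apply_eq (hG.pos y hy) fun W ↦ ?_
    have h1 := h X Y Z W
    simp only [kulkarniNomizu, riemann] at h1
    simp [apply_sharp (hG.pos y hy)]
    linear_combination h1
  rw [ricci_apply, key]
  simp only [map_add, map_sub, map_smul, LinearMap.trace_one, LinearMap.trace_smulRight,
    ← show metricTrace (G y) T = LinearMap.trace ℝ E (sharp (G y) ∘L T).toLinearMap from rfl]
  simp [apply_sharp (hG.pos y hy)]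
  ring

end Metric

/-! ### Kenmotsu identities in coordinates -/

/-- `(Φ, Ξ, η, G)` is a Kenmotsu structure on the open set `U`. -/
structure IsKenmotsuOn (U : Set E) (G : E → E →L[ℝ] E →L[ℝ] ℝ) (Φ : E → E →L[ℝ] E) (Ξ : E → E)
    (η : E → E →L[ℝ] ℝ) : Prop extends IsMetricOn U G where
  contDiffOn_endo : ContDiffOn ℝ ∞ Φ U
  contDiffOn_field : ContDiffOn ℝ ∞ Ξ U
  endo_endo : ∀ y ∈ U, ∀ v, Φ y (Φ y v) = -v + η y v • Ξ y
  form_field : ∀ y ∈ U, η y (Ξ y) = 1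
  form_eq : ∀ y ∈ U, η y = G y (Ξ y)
  metric_endo : ∀ y ∈ U, ∀ v w, G y (Φ y v) (Φ y w) = G y v w - η y v * η y w
  covDerivEndo_eq : ∀ y ∈ U, ∀ u v,
    covDerivEndo G Φ y u v = G y (Φ y u) v • Ξ y - η y v • Φ y u

namespace IsKenmotsuOn

variable {U : Set E} {G : E → E →L[ℝ] E →L[ℝ] ℝ} {Φ : E → E →L[ℝ] E} {Ξ : E → E}
  {η : E → E →L[ℝ] ℝ} {y : E}

theorem contDiffAt_field (h : IsKenmotsuOn U G Φ Ξ η) (hy : y ∈ U) : ContDiffAt ℝ ∞ Ξ y :=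
  h.contDiffOn_field.contDiffAt (h.isOpen.mem_nhds hy)

theorem differentiableAt_field (h : IsKenmotsuOn U G Φ Ξ η) (hy : y ∈ U) :
    DifferentiableAt ℝ Ξ y :=
  (h.contDiffAt_field hy).differentiableAt (by simp)

theorem form_eventuallyEq (h : IsKenmotsuOn U G Φ Ξ η) (hy : y ∈ U) :
    η =ᶠ[nhds y] fun z ↦ G z (Ξ z) := by
  filter_upwards [h.isOpen.mem_nhds hy] with z hz using h.form_eq z hz

theorem contDiffOn_form (h : IsKenmotsuOn U G Φ Ξ η) : ContDiffOn ℝ ∞ η U :=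
  (h.contDiffOn.clm_apply h.contDiffOn_field).congr h.form_eq

theorem differentiableAt_form (h : IsKenmotsuOn U G Φ Ξ η) (hy : y ∈ U) :
    DifferentiableAt ℝ η y :=
  (h.contDiffOn_form.contDiffAt (h.isOpen.mem_nhds hy)).differentiableAt (by simp)

/-- The squared length of Φξ is g(ξ,ξ) - η(ξ)² = 0. -/
theorem endo_field (h : IsKenmotsuOn U G Φ Ξ η) (hy : y ∈ U) : Φ y (Ξ y) = 0 := by
  by_contra h0
  have h1 := h.pos y hy _ h0
  rw [h.metric_endo y hy, ← h.form_eq y hy, h.form_field y hy] at h1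
  norm_num at h1

/-- Computing Φ³v as Φ²(Φv) and as Φ(Φ²v) leaves η(Φv)ξ = 0. -/
theorem form_endo (h : IsKenmotsuOn U G Φ Ξ η) (hy : y ∈ U) (v : E) : η y (Φ y v) = 0 := by
  have h1 := h.endo_endo y hy (Φ y v)
  rw [h.endo_endo y hy v, map_add, map_smul, h.endo_field hy] at h1
  have h2 : η y (Φ y v) • Ξ y = 0 := by simpa using h1
  have h3 := congrArg (η y) h2
  simpa [h.form_field y hy] using h3

/-- `∇_u ξ = u - η(u) ξ`. -/
theorem fderiv_field (h : IsKenmotsuOn U G Φ Ξ η) (hy : y ∈ U) (u : E) :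
    fderiv ℝ Ξ y u = u - η y u • Ξ y - christoffel G y u (Ξ y) := by
  -- N is ∇_u ξ. Constancy of |ξ|² gives η(N) = 0. The Kenmotsu condition at Y = ξ, with Φξ = 0
  -- differentiated, gives ΦN = Φu. A second application of Φ recovers N.
  set N := fderiv ℝ Ξ y u + christoffel G y u (Ξ y) with hN
  have hΞ := h.differentiableAt_field hy
  have hΦ : DifferentiableAt ℝ Φ y :=
    (h.contDiffOn_endo.contDiffAt (h.isOpen.mem_nhds hy)).differentiableAt (by simp)
  have d1 : fderiv ℝ Φ y u (Ξ y) + Φ y (fderiv ℝ Ξ y u) = 0 := by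
    rw [← fderiv_apply_eq hΦ hΞ]
    have : (fun z ↦ Φ z (Ξ z)) =ᶠ[nhds y] fun _ ↦ 0 := by
      filter_upwards [h.isOpen.mem_nhds hy] with z hz using h.endo_field hz
    rw [this.fderiv_eq]
    simp
  have d2 : η y N = 0 := by
    have : (fun z ↦ G z (Ξ z) (Ξ z)) =ᶠ[nhds y] fun _ ↦ (1 : ℝ) := by
      filter_upwards [h.isOpen.mem_nhds hy] with z hz
      rw [← h.form_eq z hz, h.form_field z hz]
    have h1 : fderiv ℝ (fun z ↦ G z (Ξ z) (Ξ z)) y u = 0 := by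
      rw [this.fderiv_eq]; simp
    have hG := h.differentiableAt hy
    rw [fderiv_apply_eq (A := fun z ↦ G z (Ξ z)) (hG.clm_apply hΞ) hΞ, fderiv_apply_eq hG hΞ,
      add_apply, h.fderiv_eq hy] at h1
    rw [h.form_eq y hy, hN, map_add]
    rw [h.symm y hy _ (Ξ y), h.symm y hy (fderiv ℝ Ξ y u) (Ξ y)] at h1
    linear_combination h1 / 2
  have d3 : Φ y N = Φ y u := by
    have h1 := h.covDerivEndo_eq y hy u (Ξ y)
    rw [covDerivEndo, h.endo_field hy, h.form_field y hy, h.symm y hy, ← h.form_eq y hy,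
      h.form_endo hy] at h1
    simp only [map_zero, zero_smul, add_zero, one_smul, zero_sub] at h1
    rw [hN, map_add, eq_neg_of_add_eq_zero_right d1, ← neg_inj, ← h1]
    abel
  have d4 := congrArg (Φ y) d3
  rw [h.endo_endo y hy, h.endo_endo y hy, d2, zero_smul, add_zero] at d4
  have d5 : N = u - η y u • Ξ y := by rw [← neg_inj, d4]; abel
  rw [← d5, hN]; abel

/-- `(∇_u η) v = G(u, v) - η(u) η(v)`. -/
theorem fderiv_form (h : IsKenmotsuOn U G Φ Ξ η) (hy : y ∈ U) (u v : E) :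
    fderiv ℝ η y u v = G y u v - η y u * η y v + η y (christoffel G y u v) := by
  rw [(h.form_eventuallyEq hy).fderiv_eq,
    fderiv_apply_eq (h.differentiableAt hy) (h.differentiableAt_field hy), add_apply,
    h.fderiv_eq hy, h.fderiv_field hy, h.form_eq y hy]
  simp only [map_sub, map_smul, sub_apply, smul_apply, smul_eq_mul]
  ring

/-- This is dη = 0: the covariant derivative g - η⊗η is symmetric and the connection is
torsion-free. -/
theorem fderiv_form_symm (h : IsKenmotsuOn U G Φ Ξ η) (hy : y ∈ U) (u v : E) :
    fderiv ℝ η y u v = fderiv ℝ η y v u := by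
  rw [h.fderiv_form hy, h.fderiv_form hy, h.symm y hy, h.christoffel_symm hy]
  ring

/-- Obtained by differentiating the formula for ∇_v ξ along u with v constant; it expresses the only
derivative of the connection that R(u, v)ξ requires. -/
theorem fderiv_christoffel_field (h : IsKenmotsuOn U G Φ Ξ η) (hy : y ∈ U) (u v : E) :
    fderiv ℝ (christoffel G) y u v (Ξ y) = -fderiv ℝ (fderiv ℝ Ξ) y u v
      - christoffel G y v (fderiv ℝ Ξ y u) - fderiv ℝ η y u v • Ξ y
      - η y v • fderiv ℝ Ξ y u := by
  have hΞ := h.differentiableAt_field hy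
  have hη := h.differentiableAt_form hy
  have hΓ := h.differentiableAt_christoffel hy
  have hΞ' : DifferentiableAt ℝ (fderiv ℝ Ξ) y :=
    ((h.contDiffAt_field hy).fderiv_right (m := 1) (by norm_num; exact ENat.LEInfty.out)).differentiableAt
      (by simp)
  have e : (fun z ↦ fderiv ℝ Ξ z v) =ᶠ[nhds y]
      fun z ↦ v - η z v • Ξ z - christoffel G z v (Ξ z) := by
    filter_upwards [h.isOpen.mem_nhds hy] with z hz using h.fderiv_field hz v
  have h1 : fderiv ℝ (fun z ↦ fderiv ℝ Ξ z v) y u = fderiv ℝ (fderiv ℝ Ξ) y u v := by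
    rw [fderiv_apply_eq hΞ' (by fun_prop)]; simp
  have h2 : fderiv ℝ (fun z ↦ η z v) y u = fderiv ℝ η y u v := by
    rw [fderiv_apply_eq hη (by fun_prop)]; simp
  have h3 : fderiv ℝ (fun z ↦ christoffel G z v (Ξ z)) y u =
      fderiv ℝ (christoffel G) y u v (Ξ y) + christoffel G y v (fderiv ℝ Ξ y u) := by
    rw [fderiv_apply_eq (A := fun z ↦ christoffel G z v) (by fun_prop) hΞ,
      fderiv_apply_eq (A := fun z ↦ christoffel G z) hΓ (by fun_prop)]
    simp
  rw [e.fderiv_eq, fderiv_fun_sub (by fun_prop) (by fun_prop),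
    fderiv_fun_sub (by fun_prop) (by fun_prop), fderiv_fun_smul (by fun_prop) hΞ, sub_apply,
    h3] at h1
  simp [h2] at h1
  rw [← h1]
  module

/-- `R(u, v) ξ = η(u) v - η(v) u`. -/
theorem curvature_field (h : IsKenmotsuOn U G Φ Ξ η) (hy : y ∈ U) (u v : E) :
    curvature G y v (Ξ y) u = η y u • v - η y v • u := by
  have hs : IsSymmSndFDerivAt ℝ Ξ y := (h.contDiffAt_field hy).isSymmSndFDerivAt (by simp; exact ENat.LEInfty.out)
  -- On antisymmetrizing, second derivatives of ξ cancel by symmetry, derivatives of η by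
  -- closedness, and the quadratic terms in Γ against those coming from the derivative of ξ.
  rw [curvature_apply, h.fderiv_christoffel_field hy, h.fderiv_christoffel_field hy, hs.eq u v,
    h.fderiv_form_symm hy u v, h.fderiv_field hy, h.fderiv_field hy]
  simp only [map_sub, map_smul]
  rw [h.christoffel_symm hy u v]
  module

/-- The trace of u ↦ η(u)ξ - u. This value is what later fixes the unknown scalar in the Ricci
tensor. -/
theorem ricci_field_field (h : IsKenmotsuOn U G Φ Ξ η) (hy : y ∈ U) :
    ricci G y (Ξ y) (Ξ y) = 1 - Module.finrank ℝ E := by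
  have : curvature G y (Ξ y) (Ξ y) = (η y : E →ₗ[ℝ] ℝ).smulRight (Ξ y) - 1 := by
    ext u
    simp [h.curvature_field hy, h.form_field y hy]
  rw [ricci_apply, this, map_sub, LinearMap.trace_smulRight, LinearMap.trace_one]
  simp [h.form_field y hy]

/-- The Hessian in the direction of the Reeb field. -/
theorem hessian_field_field (h : IsKenmotsuOn U G Φ Ξ η) (hy : y ∈ U) {F : E → ℝ}
    (hF : ContDiffAt ℝ ∞ F y) :
    hessian G F y (Ξ y) (Ξ y) = fderiv ℝ (fun z ↦ fderiv ℝ F z (Ξ z)) y (Ξ y) := by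
  have hF' : DifferentiableAt ℝ (fderiv ℝ F) y :=
    (hF.fderiv_right (m := 1) (by norm_num; exact ENat.LEInfty.out)).differentiableAt (by simp)
  rw [fderiv_apply_eq hF' (h.differentiableAt_field hy), h.fderiv_field hy, h.form_field y hy]
  simp [hessian, sub_eq_add_neg]

end IsKenmotsuOn

end Coord

/-! ### Connection, curvature and Hessian of the deformed metric -/

namespace Coord

variable {E : Type*} [NormedAddCommGroup E] [NormedSpace ℝ E] [FiniteDimensional ℝ E]

/-- The metric of the `D`-homothetic deformation with constant `a`. -/
noncomputable def deform (G : E → E →L[ℝ] E →L[ℝ] ℝ) (η : E → E →L[ℝ] ℝ) (a : ℝ) (y : E) :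
    E →L[ℝ] E →L[ℝ] ℝ :=
  a • G y + (a * (a - 1)) • (η y).smulRight (η y)

theorem deform_apply (G : E → E →L[ℝ] E →L[ℝ] ℝ) (η : E → E →L[ℝ] ℝ) (a : ℝ) (y u v : E) :
    deform G η a y u v = a * G y u v + a * (a - 1) * (η y u * η y v) := by
  simp [deform]

namespace IsKenmotsuOn

variable {U : Set E} {G : E → E →L[ℝ] E →L[ℝ] ℝ} {Φ : E → E →L[ℝ] E} {Ξ : E → E}
  {η : E → E →L[ℝ] ℝ} {y : E} {a : ℝ}

theorem isMetricOn_deform (h : IsKenmotsuOn U G Φ Ξ η) (ha : 0 < a) :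
    IsMetricOn U (deform G η a) where
  isOpen := h.isOpen
  contDiffOn := by
    have hη := h.contDiffOn_form
    exact (h.contDiffOn.const_smul a).add ((hη.smulRight hη).const_smul _)
  symm y hy u v := by
    rw [deform_apply, deform_apply, h.symm y hy]; ring
  pos y hy u hu := by
    -- The deformed metric is a(g - η⊗η) + a² η⊗η, and g - η⊗η is nonnegative since it equals g(Φ·,
    -- Φ·).
    have h1 : 0 ≤ G y u u - η y u * η y u := by
      rw [← h.metric_endo y hy]
      by_cases h0 : Φ y u = 0
      · simp [h0]
      · exact (h.pos y hy _ h0).le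
    have h2 := h.pos y hy u hu
    rw [deform_apply]
    by_cases h0 : η y u = 0
    · rw [h0]; nlinarith
    · have h3 : 0 < η y u * η y u := mul_self_pos.2 h0
      have : a * G y u u + a * (a - 1) * (η y u * η y u) =
        a * (G y u u - η y u * η y u) + a ^ 2 * (η y u * η y u) := by ring
      rw [this]; positivity

theorem fderiv_deform (h : IsKenmotsuOn U G Φ Ξ η) (ha : 0 < a) (hy : y ∈ U) (u v w : E) :
    fderiv ℝ (deform G η a) y u v w = a * fderiv ℝ G y u v w +
      a * (a - 1) * (fderiv ℝ η y u v * η y w + η y v * fderiv ℝ η y u w) := by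
  have hG := h.differentiableAt hy
  have hη := h.differentiableAt_form hy
  have hv : ∀ v, fderiv ℝ (fun z ↦ η z v) y u = fderiv ℝ η y u v := fun v ↦ by
    rw [fderiv_apply_eq hη (by fun_prop)]; simp
  rw [← fderiv_apply_apply_eq ((h.isMetricOn_deform ha).differentiableAt hy)]
  simp only [deform_apply]
  rw [fderiv_fun_add (by fun_prop) (by fun_prop), fderiv_const_mul (by fun_prop),
    fderiv_const_mul (by fun_prop), fderiv_fun_mul (by fun_prop) (by fun_prop)]
  simp only [add_apply, smul_apply, fderiv_apply_apply_eq hG, hv, smul_eq_mul]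
  ring

/-- As η is closed, the Koszul formula retains from η⊗η only a(a-1)(∇_u η)(v) η(w), beyond the term
absorbed by Γ. The deformed metric pairs ξ with w to a² η(w), whence the factor (a-1)/a. -/
theorem christoffel_deform (h : IsKenmotsuOn U G Φ Ξ η) (ha : 0 < a) (hy : y ∈ U) (u v : E) :
    christoffel (deform G η a) y u v =
      christoffel G y u v + ((a - 1) / a * (G y u v - η y u * η y v)) • Ξ y := by
  refine eq_of_forall_apply_eq ((h.isMetricOn_deform ha).pos y hy) fun w ↦ ?_
  have h1 := h.apply_christoffel hy u v w
  have h2 := h.fderiv_form hy u v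
  rw [(h.isMetricOn_deform ha).apply_christoffel hy, h.fderiv_deform ha hy, h.fderiv_deform ha hy,
    h.fderiv_deform ha hy, deform_apply, h.fderiv_form_symm hy v u, h.fderiv_form_symm hy w u,
    h.fderiv_form_symm hy w v]
  simp only [map_add, map_smul, add_apply, smul_apply, smul_eq_mul, h.form_field y hy,
    ← h.form_eq y hy]
  have hk : (a - 1) / a * a = a - 1 := by field_simp
  linear_combination a * (a - 1) * η y w * h2 - a * h1 -
    a * (G y u v - η y u * η y v) * η y w * hk

theorem fderiv_christoffel_deform (h : IsKenmotsuOn U G Φ Ξ η) (ha : 0 < a) (hy : y ∈ U)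
    (u v w : E) :
    fderiv ℝ (christoffel (deform G η a)) y u v w = fderiv ℝ (christoffel G) y u v w +
      (((a - 1) / a) * (fderiv ℝ G y u v w - fderiv ℝ η y u v * η y w
        - η y v * fderiv ℝ η y u w)) • Ξ y
      + ((a - 1) / a * (G y v w - η y v * η y w)) • fderiv ℝ Ξ y u := by
  have hG := h.differentiableAt hy
  have hη := h.differentiableAt_form hy
  have hΓ := h.differentiableAt_christoffel hy
  have hΞ := h.differentiableAt_field hy
  have hv : ∀ v, fderiv ℝ (fun z ↦ η z v) y u = fderiv ℝ η y u v := fun v ↦ by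
    rw [fderiv_apply_eq hη (by fun_prop)]; simp
  have e : (fun z ↦ christoffel (deform G η a) z v w) =ᶠ[nhds y] fun z ↦ christoffel G z v w +
      ((a - 1) / a * (G z v w - η z v * η z w)) • Ξ z := by
    filter_upwards [h.isOpen.mem_nhds hy] with z hz using h.christoffel_deform ha hz v w
  rw [← fderiv_apply_apply_eq ((h.isMetricOn_deform ha).differentiableAt_christoffel hy),
    e.fderiv_eq, fderiv_fun_add (by fun_prop) (by fun_prop), fderiv_fun_smul (by fun_prop) hΞ,
    fderiv_const_mul (by fun_prop), fderiv_fun_sub (by fun_prop) (by fun_prop),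
    fderiv_fun_mul (by fun_prop) (by fun_prop)]
  simp only [add_apply, sub_apply, smul_apply, ContinuousLinearMap.smulRight_apply,
    fderiv_apply_apply_eq hG, fderiv_apply_apply_eq hΓ, hv, smul_eq_mul]
  module

/-- The difference tensor k(g - η⊗η)ξ vanishes when one argument is ξ, so its quadratic contribution
is zero. In its antisymmetrized covariant derivative the ξ-components cancel. -/
theorem curvature_deform (h : IsKenmotsuOn U G Φ Ξ η) (ha : 0 < a) (hy : y ∈ U) (u v w : E) :
    curvature (deform G η a) y v w u = curvature G y v w u +
      ((a - 1) / a) • ((G y v w - η y v * η y w) • u - (G y u w - η y u * η y w) • v) := by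
  rw [curvature_apply, curvature_apply, h.fderiv_christoffel_deform ha hy,
    h.fderiv_christoffel_deform ha hy, h.fderiv_form_symm hy v u]
  simp only [h.christoffel_deform ha hy, h.fderiv_eq hy, h.fderiv_form hy, h.fderiv_field hy,
    map_add, map_smul, ← h.form_eq y hy, h.form_field y hy, h.symm y hy _ (Ξ y), smul_eq_mul]
  rw [h.christoffel_symm hy v u]
  module

theorem ricci_deform (h : IsKenmotsuOn U G Φ Ξ η) (ha : 0 < a) (hy : y ∈ U) (v w : E) :
    ricci (deform G η a) y v w = ricci G y v w +
      (Module.finrank ℝ E - 1) * ((a - 1) / a) * (G y v w - η y v * η y w) := by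
  have : curvature (deform G η a) y v w = curvature G y v w +
      ((a - 1) / a) • ((G y v w - η y v * η y w) • (1 : E →ₗ[ℝ] E)
        - (((G y).flip w - η y w • η y : E →L[ℝ] ℝ) : E →ₗ[ℝ] ℝ).smulRight v) := by
    ext u
    rw [h.curvature_deform ha hy]
    simp [mul_comm]
  rw [ricci_apply, ricci_apply, this]
  simp only [map_add, map_sub, map_smul, LinearMap.trace_one, LinearMap.trace_smulRight]
  simp
  ring

theorem hessian_deform (h : IsKenmotsuOn U G Φ Ξ η) (ha : 0 < a) (hy : y ∈ U) (F : E → ℝ)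
    (v w : E) :
    hessian (deform G η a) F y v w = hessian G F y v w -
      ((a - 1) / a) * fderiv ℝ F y (Ξ y) * (G y v w - η y v * η y w) := by
  simp [hessian, h.christoffel_deform ha hy]
  ring

/-- The Ricci tensor of a Kenmotsu metric for which the gradient of `F` is an almost Riemann
soliton of the deformed metric. -/
theorem exists_ricci_eq (h : IsKenmotsuOn U G Φ Ξ η) (ha : 0 < a) (hy : y ∈ U) {F : E → ℝ}
    (hF : ContDiffAt ℝ ∞ F y) {V : E → E} (hV : DifferentiableAt ℝ V y)
    (hVF : ∀ z ∈ U, deform G η a z (V z) = fderiv ℝ F z) {l : ℝ}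
    (hsol : ∀ X Y Z W, (1 / 2) * kulkarniNomizu (lieDerivMetric (deform G η a) V y)
        (deform G η a y) X Y Z W + riemann (deform G η a) y X Y Z W =
      l * ((1 / 2) * kulkarniNomizu (deform G η a y) (deform G η a y) X Y Z W)) :
    ∃ s : ℝ, ∀ N k t : ℝ, N = Module.finrank ℝ E → k = (a - 1) / a → t = fderiv ℝ F y (Ξ y) →
      ricci G y = (-(N - 2)) • hessian G F y + ((N - 2) * k * t - (N - 1) * k - s * a) • G y
        + (-((N - 2) * k * t) + (N - 1) * k - s * (a * (a - 1))) •
          (G y (Ξ y)).smulRight (G y (Ξ y)) := by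
  have hM := h.isMetricOn_deform ha
  obtain ⟨s, hs⟩ := hM.exists_ricci_eq hy (T := hessian (deform G η a) F y) (l := l) (by
    intro X Y Z W
    rw [← hsol, hM.lieDerivMetric_eq hy hV hF hVF]
    simp only [kulkarniNomizu, smul_apply, smul_eq_mul]
    ring)
  refine ⟨s, ?_⟩
  -- The variables N, k, t are quantified so that the dimension, (a-1)/a and ξ(F) may be replaced by
  -- other expressions when the formula is used.
  rintro _ _ _ rfl rfl rfl
  ext v w
  have h1 := h.ricci_deform ha hy v w
  rw [hs] at h1
  simp only [neg_apply, add_apply, smul_apply, smul_eq_mul, h.hessian_deform ha hy,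
    deform_apply] at h1
  simp only [← h.form_eq y hy, add_apply, smul_apply, smul_eq_mul,
    ContinuousLinearMap.smulRight_apply]
  linear_combination -h1

end IsKenmotsuOn

end Coord

/-! ### Smoothness and differentials read in a chart -/

section Chart

variable {E : Type*} [NormedAddCommGroup E] [NormedSpace ℝ E]
  {M : Type*} [TopologicalSpace M] [ChartedSpace E M]

theorem fieldIn_apply (c : OpenPartialHomeomorph M E) (X : Π x : M, TangentSpace 𝓘(ℝ, E) x)
    (y : E) : fieldIn c X y = chartDeriv c (c.symm y) (X (c.symm y)) := rfl

theorem formIn_apply (c : OpenPartialHomeomorph M E)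
    (α : Π x : M, TangentSpace 𝓘(ℝ, E) x →L[ℝ] ℝ) (y v : E) :
    formIn c α y v = α (c.symm y) (chartSymmDeriv c y v) := rfl

theorem endoIn_apply (c : OpenPartialHomeomorph M E)
    (Φ : Π x : M, TangentSpace 𝓘(ℝ, E) x →L[ℝ] TangentSpace 𝓘(ℝ, E) x) (y v : E) :
    endoIn c Φ y v = chartDeriv c (c.symm y) (Φ (c.symm y) (chartSymmDeriv c y v)) := rfl

theorem bilinIn_apply (c : OpenPartialHomeomorph M E)
    (A : Π x : M, TangentSpace 𝓘(ℝ, E) x →L[ℝ] TangentSpace 𝓘(ℝ, E) x →L[ℝ] ℝ) (y u v : E) :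
    bilinIn c A y u v = A (c.symm y) (chartSymmDeriv c y u) (chartSymmDeriv c y v) := rfl

variable [IsManifold 𝓘(ℝ, E) ∞ M]

theorem mdifferentiable_chartAt (x₀ : M) :
    (chartAt E x₀).MDifferentiable 𝓘(ℝ, E) 𝓘(ℝ, E) :=
  haveI : IsManifold 𝓘(ℝ, E) 1 M := .of_le (n := ∞) (by exact_mod_cast le_top)
  mdifferentiable_of_mem_atlas (chart_mem_atlas E x₀)

variable {x₀ : M} {y : E}

theorem chartDeriv_chartSymmDeriv (hy : y ∈ (chartAt E x₀).target) (v : E) :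
    chartDeriv (chartAt E x₀) ((chartAt E x₀).symm y) (chartSymmDeriv (chartAt E x₀) y v) = v :=
  DFunLike.congr_fun ((mdifferentiable_chartAt x₀).comp_symm_deriv hy) v

theorem chartSymmDeriv_chartDeriv (hy : y ∈ (chartAt E x₀).target)
    (v : TangentSpace 𝓘(ℝ, E) ((chartAt E x₀).symm y)) :
    chartSymmDeriv (chartAt E x₀) y (chartDeriv (chartAt E x₀) ((chartAt E x₀).symm y) v) = v := by
  have h := (mdifferentiable_chartAt x₀).symm_comp_deriv ((chartAt E x₀).map_target hy)
  rw [(chartAt E x₀).right_inv hy] at h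
  exact DFunLike.congr_fun h v

/-- A tangent vector field that is constant in the trivialization of a chart is smooth. -/
theorem contMDiffOn_symmL (v : E) :
    ContMDiffOn 𝓘(ℝ, E) (𝓘(ℝ, E).prod 𝓘(ℝ, E)) ∞
      (fun x ↦ Bundle.TotalSpace.mk' E (E := fun x : M ↦ TangentSpace 𝓘(ℝ, E) x) x
        ((trivializationAt E (TangentSpace 𝓘(ℝ, E) (M := M)) x₀).symmL ℝ x v))
      (chartAt E x₀).source := by
  let e := trivializationAt E (TangentSpace 𝓘(ℝ, E) (M := M)) x₀
  have hb : e.baseSet = (chartAt E x₀).source := rfl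
  rw [← hb, e.contMDiffOn_section_baseSet_iff]
  refine (contMDiffOn_const (c := v)).congr fun x hx ↦ ?_
  have := e.continuousLinearMapAt_symmL (R := ℝ) hx v
  rw [Bundle.Trivialization.continuousLinearMapAt_apply, e.linearMapAt_apply, if_pos hx] at this
  exact this

/-- Bundle smoothness is phrased through the trivialization, coordinate readings through the chart
differential; this identification carries one to the other. -/
theorem continuousLinearMapAt_eq_chartDeriv {x : M} (hx : x ∈ (chartAt E x₀).source)
    (v : TangentSpace 𝓘(ℝ, E) x) :
    (trivializationAt E (TangentSpace 𝓘(ℝ, E) (M := M)) x₀).continuousLinearMapAt ℝ x v =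
      chartDeriv (chartAt E x₀) x v := by
  have : IsManifold 𝓘(ℝ, E) 1 M := .of_le (n := ∞) (by exact_mod_cast le_top)
  exact DFunLike.congr_fun
    (TangentBundle.continuousLinearMapAt_trivializationAt (I := 𝓘(ℝ, E)) hx) v

theorem symmL_eq_chartSymmDeriv (hy : y ∈ (chartAt E x₀).target) (v : E) :
    (trivializationAt E (TangentSpace 𝓘(ℝ, E) (M := M)) x₀).symmL ℝ ((chartAt E x₀).symm y) v =
      chartSymmDeriv (chartAt E x₀) y v := by
  have hs := (chartAt E x₀).map_target hy
  rw [← chartSymmDeriv_chartDeriv hy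
    ((trivializationAt E (TangentSpace 𝓘(ℝ, E) (M := M)) x₀).symmL ℝ ((chartAt E x₀).symm y) v),
    ← continuousLinearMapAt_eq_chartDeriv hs,
    (trivializationAt E (TangentSpace 𝓘(ℝ, E) (M := M)) x₀).continuousLinearMapAt_symmL hs]

theorem contDiffOn_fieldIn_of_contMDiffOn {X : Π x : M, TangentSpace 𝓘(ℝ, E) x}
    (hX : ContMDiffOn 𝓘(ℝ, E) (𝓘(ℝ, E).prod 𝓘(ℝ, E)) ∞
      (fun x ↦ Bundle.TotalSpace.mk' E (E := fun x : M ↦ TangentSpace 𝓘(ℝ, E) x) x (X x))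
      (chartAt E x₀).source) :
    ContDiffOn ℝ ∞ (fieldIn (chartAt E x₀) X) (chartAt E x₀).target := by
  let e := trivializationAt E (TangentSpace 𝓘(ℝ, E) (M := M)) x₀
  have h1 := (e.contMDiffOn_section_baseSet_iff (IB := 𝓘(ℝ, E)) (n := ∞) (s := X)).1 hX
  have h2 : ContMDiffOn 𝓘(ℝ, E) 𝓘(ℝ, E) ∞ (chartAt E x₀).symm (chartAt E x₀).target :=
    contMDiffOn_chart_symm
  rw [← contMDiffOn_iff_contDiffOn]
  refine (h1.comp h2 fun y hy ↦ (chartAt E x₀).map_target hy).congr fun y hy ↦ ?_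
  have hs : (chartAt E x₀).symm y ∈ e.baseSet := (chartAt E x₀).map_target hy
  have h4 := continuousLinearMapAt_eq_chartDeriv hs (X ((chartAt E x₀).symm y))
  rw [Bundle.Trivialization.continuousLinearMapAt_apply, e.linearMapAt_apply, if_pos hs] at h4
  exact h4.symm

theorem contDiffOn_comp_symm {f : M → ℝ}
    (hf : ContMDiffOn 𝓘(ℝ, E) 𝓘(ℝ, ℝ) ∞ f (chartAt E x₀).source) :
    ContDiffOn ℝ ∞ (f ∘ (chartAt E x₀).symm) (chartAt E x₀).target := by
  rw [← contMDiffOn_iff_contDiffOn]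
  have h2 : ContMDiffOn 𝓘(ℝ, E) 𝓘(ℝ, E) ∞ (chartAt E x₀).symm (chartAt E x₀).target :=
    contMDiffOn_chart_symm
  exact hf.comp h2 fun y hy ↦ (chartAt E x₀).map_target hy

/-- The differential of a function, in a chart. -/
theorem mfderiv_chartSymmDeriv {f : M → ℝ} (hy : y ∈ (chartAt E x₀).target)
    (hf : MDifferentiableAt 𝓘(ℝ, E) 𝓘(ℝ, ℝ) f ((chartAt E x₀).symm y)) (v : E) :
    mfderiv 𝓘(ℝ, E) 𝓘(ℝ, ℝ) f ((chartAt E x₀).symm y) (chartSymmDeriv (chartAt E x₀) y v) =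
      fderiv ℝ (f ∘ (chartAt E x₀).symm) y v := by
  have h := mfderiv_comp y hf ((mdifferentiable_chartAt x₀).mdifferentiableAt_symm hy)
  rw [mfderiv_eq_fderiv] at h
  exact (DFunLike.congr_fun h v).symm

theorem dirDeriv_eq {f : M → ℝ} (X : Π x : M, TangentSpace 𝓘(ℝ, E) x)
    (hy : y ∈ (chartAt E x₀).target)
    (hf : MDifferentiableAt 𝓘(ℝ, E) 𝓘(ℝ, ℝ) f ((chartAt E x₀).symm y)) :
    dirDeriv X f ((chartAt E x₀).symm y) =
      fderiv ℝ (f ∘ (chartAt E x₀).symm) y (fieldIn (chartAt E x₀) X y) := by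
  rw [← mfderiv_chartSymmDeriv hy hf, fieldIn, chartSymmDeriv_chartDeriv hy, dirDeriv]

/-- Intended for ξ(f), whose smoothness is known only through its chart expression. -/
theorem mdifferentiableAt_of_contDiffOn {f : M → ℝ}
    (hf : ContDiffOn ℝ ∞ (f ∘ (chartAt E x₀).symm) (chartAt E x₀).target)
    {x : M} (hx : x ∈ (chartAt E x₀).source) : MDifferentiableAt 𝓘(ℝ, E) 𝓘(ℝ, ℝ) f x := by
  have hy := (chartAt E x₀).map_source hx
  have h1 : DifferentiableAt ℝ (f ∘ (chartAt E x₀).symm) (chartAt E x₀ x) :=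
    (hf.contDiffAt ((chartAt E x₀).open_target.mem_nhds hy)).differentiableAt (by simp)
  have h2 := h1.mdifferentiableAt.comp x ((mdifferentiable_chartAt x₀).mdifferentiableAt hx)
  refine h2.congr_of_eventuallyEq ?_
  filter_upwards [(chartAt E x₀).open_source.mem_nhds hx] with z hz
  simp [(chartAt E x₀).left_inv hz]

variable [FiniteDimensional ℝ E]

theorem contDiffOn_bilinIn
    {g : Π x : M, TangentSpace 𝓘(ℝ, E) x →L[ℝ] TangentSpace 𝓘(ℝ, E) x →L[ℝ] ℝ}
    (hg : ContMDiff 𝓘(ℝ, E) (𝓘(ℝ, E).prod 𝓘(ℝ, E →L[ℝ] E →L[ℝ] ℝ)) ∞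
      (fun x ↦ Bundle.TotalSpace.mk' (E →L[ℝ] E →L[ℝ] ℝ)
        (E := fun x : M ↦ TangentSpace 𝓘(ℝ, E) x →L[ℝ] TangentSpace 𝓘(ℝ, E) x →L[ℝ]
          Bundle.Trivial M ℝ x) x (g x))) :
    ContDiffOn ℝ ∞ (bilinIn (chartAt E x₀) g) (chartAt E x₀).target := by
  -- In finite dimension it suffices to test on constant coordinate vectors, which come from smooth
  -- local fields on the manifold.
  refine contDiffOn_clm_apply.2 fun u ↦ contDiffOn_clm_apply.2 fun v ↦ ?_
  have h : ContMDiffOn 𝓘(ℝ, E) (𝓘(ℝ, E).prod 𝓘(ℝ, ℝ)) ∞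
      (fun x ↦ Bundle.TotalSpace.mk' ℝ (E := Bundle.Trivial M ℝ) x (g x
        ((trivializationAt E (TangentSpace 𝓘(ℝ, E) (M := M)) x₀).symmL ℝ x u)
        ((trivializationAt E (TangentSpace 𝓘(ℝ, E) (M := M)) x₀).symmL ℝ x v)))
      (chartAt E x₀).source :=
    ContMDiffOn.clm_bundle_apply₂ (F₁ := E) (F₂ := E) hg.contMDiffOn (contMDiffOn_symmL u)
      (contMDiffOn_symmL v)
  have h' : ContMDiffOn 𝓘(ℝ, E) 𝓘(ℝ, ℝ) ∞ (fun x ↦ g x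
        ((trivializationAt E (TangentSpace 𝓘(ℝ, E) (M := M)) x₀).symmL ℝ x u)
        ((trivializationAt E (TangentSpace 𝓘(ℝ, E) (M := M)) x₀).symmL ℝ x v))
      (chartAt E x₀).source := fun x hx ↦ by
    have := h x hx
    rw [Bundle.contMDiffWithinAt_totalSpace] at this
    exact this.2
  refine (contDiffOn_comp_symm h').congr fun y hy ↦ ?_
  rw [bilinIn_apply, Function.comp_apply, symmL_eq_chartSymmDeriv hy, symmL_eq_chartSymmDeriv hy]

theorem contDiffOn_endoIn
    {Φ : Π x : M, TangentSpace 𝓘(ℝ, E) x →L[ℝ] TangentSpace 𝓘(ℝ, E) x}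
    (hΦ : ContMDiff 𝓘(ℝ, E) (𝓘(ℝ, E).prod 𝓘(ℝ, E →L[ℝ] E)) ∞
      (fun x ↦ Bundle.TotalSpace.mk' (E →L[ℝ] E)
        (E := fun x : M ↦ TangentSpace 𝓘(ℝ, E) x →L[ℝ] TangentSpace 𝓘(ℝ, E) x) x (Φ x))) :
    ContDiffOn ℝ ∞ (endoIn (chartAt E x₀) Φ) (chartAt E x₀).target := by
  refine contDiffOn_clm_apply.2 fun u ↦ ?_
  have h := contDiffOn_fieldIn_of_contMDiffOn
    (ContMDiffOn.clm_bundle_apply (F₁ := E) (F₂ := E) hΦ.contMDiffOn (contMDiffOn_symmL (x₀ := x₀) u))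
  refine h.congr fun y hy ↦ ?_
  rw [fieldIn, symmL_eq_chartSymmDeriv hy]
  rfl

end Chart

/-! ### From the manifold structure to its coordinate form -/

namespace AlmostContactMetricStructure

variable {E : Type*} [NormedAddCommGroup E] [NormedSpace ℝ E]
  {M : Type*} [TopologicalSpace M] [ChartedSpace E M] [IsManifold 𝓘(ℝ, E) ∞ M]
  (S : AlmostContactMetricStructure E M)

theorem bilinIn_deformedMetric (a : ℝ) (c : OpenPartialHomeomorph M E) :
    bilinIn c (S.deformedMetric a) = Coord.deform (bilinIn c S.g) (formIn c S.η) a := by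
  funext y
  ext u v
  rfl

variable [FiniteDimensional ℝ E]

theorem isKenmotsuOn (hS : S.IsKenmotsu) (x₀ : M) :
    Coord.IsKenmotsuOn (chartAt E x₀).target (bilinIn (chartAt E x₀) S.g)
      (endoIn (chartAt E x₀) S.φ) (fieldIn (chartAt E x₀) S.ξ) (formIn (chartAt E x₀) S.η) where
  isOpen := (chartAt E x₀).open_target
  contDiffOn := contDiffOn_bilinIn S.metric.contMDiff
  symm y _ u v := S.metric.symm _ _ _
  pos y hy u hu := by
    rw [bilinIn_apply]
    refine S.metric.pos _ _ fun h0 ↦ hu ?_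
    exact (chartDeriv_chartSymmDeriv hy u).symm.trans ((congrArg _ h0).trans (map_zero _))
  contDiffOn_endo := contDiffOn_endoIn S.contMDiff_φ
  contDiffOn_field := contDiffOn_fieldIn_of_contMDiffOn S.contMDiff_ξ.contMDiffOn
  endo_endo y hy v := by
    rw [endoIn_apply, endoIn_apply, chartSymmDeriv_chartDeriv hy, S.φ_φ, map_add, map_neg,
      map_smul, chartDeriv_chartSymmDeriv hy, formIn_apply, fieldIn_apply]
  form_field y hy := by
    rw [formIn_apply, fieldIn_apply, chartSymmDeriv_chartDeriv hy, S.η_ξ]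
  form_eq y hy := by
    ext v
    rw [formIn_apply, bilinIn_apply, fieldIn_apply, chartSymmDeriv_chartDeriv hy, S.η_eq, g]
  metric_endo y hy v w := by
    rw [bilinIn_apply, bilinIn_apply, endoIn_apply, endoIn_apply, chartSymmDeriv_chartDeriv hy,
      chartSymmDeriv_chartDeriv hy, formIn_apply, formIn_apply, g, S.metric_φ_φ]
  covDerivEndo_eq y hy u v := hS _ (chart_mem_atlas E x₀) y hy u v

/-- The defining property of the gradient survives passage to the chart; it is what turns the Lie
derivative into a Hessian. -/
theorem deform_fieldIn_grad (hS : S.IsKenmotsu) {a : ℝ} (ha : 0 < a) {f : M → ℝ}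
    (hf : ContMDiff 𝓘(ℝ, E) 𝓘(ℝ, ℝ) ∞ f) (x₀ : M) {y : E} (hy : y ∈ (chartAt E x₀).target) :
    Coord.deform (bilinIn (chartAt E x₀) S.g) (formIn (chartAt E x₀) S.η) a y
      (fieldIn (chartAt E x₀) (grad (S.deformedMetric a) f) y) =
      fderiv ℝ (f ∘ (chartAt E x₀).symm) y := by
  have hpos := ((S.isKenmotsuOn hS x₀).isMetricOn_deform ha).pos y hy
  rw [← S.bilinIn_deformedMetric] at hpos ⊢
  ext v
  have hmd : MDifferentiableAt 𝓘(ℝ, E) 𝓘(ℝ, ℝ) f ((chartAt E x₀).symm y) :=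
    hf.mdifferentiableAt (by simp)
  rw [bilinIn_apply, fieldIn, chartSymmDeriv_chartDeriv hy, ← mfderiv_chartSymmDeriv hy hmd]
  -- The gradient is formed in the tangent space, so positivity must be carried back there from the
  -- chart.
  have hpos' : ∀ u : TangentSpace 𝓘(ℝ, E) ((chartAt E x₀).symm y), u ≠ 0 →
      0 < S.deformedMetric a ((chartAt E x₀).symm y) u u := fun u hu ↦ by
    have h1 := hpos (chartDeriv (chartAt E x₀) ((chartAt E x₀).symm y) u) fun h0 ↦ hu (by
      rw [← chartSymmDeriv_chartDeriv hy u, h0, map_zero])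
    rwa [bilinIn_apply, chartSymmDeriv_chartDeriv hy] at h1
  exact DFunLike.congr_fun (apply_sharp (E := E) hpos' _) _

end AlmostContactMetricStructure

/-! ### Comparison of scalars and the inequality -/

/-- The gap in the Ricci inequality is a square, for scalars related as the traces of the
tensors in `mainTheorem9` are. -/
theorem scalar_identity {n a H D h h' s α β : ℝ} (ha : a ≠ 0) (hn : 2 * n + 1 ≠ 0)
    (hα : α = (2 * n - 1) * ((a - 1) / a) * h - 2 * n * ((a - 1) / a) - s * a)
    (hβ : β = -((2 * n - 1) * ((a - 1) / a) * h) + 2 * n * ((a - 1) / a) - s * (a * (a - 1)))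
    (hs : -(2 * n - 1) * h' + α + β = -2 * n) :
    (-(2 * n - 1)) ^ 2 * H + 2 * (-(2 * n - 1)) * α * D + 2 * (-(2 * n - 1)) * β * h'
        + α ^ 2 * (2 * n + 1) + 2 * α * β + β ^ 2
      - ((2 * n - 1) ^ 2 * H
        - 4 * n * ((a - 1) / a) * (-(2 * n - 1) * D + α * (2 * n + 1) + β)
        - 4 * n ^ 2 * (2 * n + 1) * ((a - 1) / a) ^ 2
        - (2 * n - 1) ^ 2 / (2 * n + 1) * D ^ 2
        - 2 * (2 * n - 1) ^ 2 / (2 * n + 1) * ((a - 1) / a) * (h - h') * D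
        + 2 * n * (2 * n - 1) ^ 2 / (2 * n + 1) * ((a - 1) / a) ^ 2 * h ^ 2
        - 2 * (2 * n - 1) ^ 2 * (n + n * a + a) * (a - 1) / ((2 * n + 1) * a ^ 2) * h' ^ 2
        + 2 * (2 * n - 1) ^ 2 * (2 * n + a) * (a - 1) / ((2 * n + 1) * a ^ 2) * (h * h')) =
      (-4 * n ^ 2 + (2 * n - 1) * (2 * n * h' / a - (D - h') + 2 * n * ((a - 1) / a) * h)
        + 4 * n ^ 2 * ((a - 1) / a) - 2 * n / a) ^ 2 / (2 * n + 1) := by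
  -- In α + β everything cancels except -s a², so `hs` determines s. With this value the squared
  -- quantity is scal + 2n(2n+1)(a-1)/a, the trace of T.
  have hs' : s = (2 * n - (2 * n - 1) * h') / a ^ 2 := by
    field_simp
    linear_combination -hs + hα + hβ
  subst hα hβ hs'
  field_simp
  ring

theorem mainTheorem9 {E : Type*} [NormedAddCommGroup E] [NormedSpace ℝ E] [FiniteDimensional ℝ E]
    {M : Type*} [TopologicalSpace M] [ChartedSpace E M] [IsManifold 𝓘(ℝ, E) ∞ M]
    (n : ℕ) (hn : Module.finrank ℝ E = 2 * n + 1)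
    (S : AlmostContactMetricStructure E M) (hS : S.IsKenmotsu)
    (a : ℝ) (ha : 0 < a)
    (f : M → ℝ) (hf : ContMDiff 𝓘(ℝ, E) 𝓘(ℝ, ℝ) ∞ f) (lam : M → ℝ)
    (hsol : IsAlmostRiemannSoliton (S.deformedMetric a) (grad (S.deformedMetric a) f) lam)
    (p : M) :
    ricciNormSq S.g p ≥
      (2 * (n : ℝ) - 1) ^ 2 * hessNormSq S.g f p
      - 4 * n * ((a - 1) / a) * scal S.g p
      - 4 * n ^ 2 * (2 * n + 1) * ((a - 1) / a) ^ 2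
      - (2 * n - 1) ^ 2 / (2 * n + 1) * laplacian S.g f p ^ 2
      - 2 * (2 * n - 1) ^ 2 / (2 * n + 1) * ((a - 1) / a)
        * (dirDeriv S.ξ f p - dirDeriv S.ξ (dirDeriv S.ξ f) p) * laplacian S.g f p
      + 2 * n * (2 * n - 1) ^ 2 / (2 * n + 1) * ((a - 1) / a) ^ 2 * dirDeriv S.ξ f p ^ 2
      - 2 * (2 * n - 1) ^ 2 * (n + n * a + a) * (a - 1) / ((2 * n + 1) * a ^ 2)
        * dirDeriv S.ξ (dirDeriv S.ξ f) p ^ 2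
      + 2 * (2 * n - 1) ^ 2 * (2 * n + a) * (a - 1) / ((2 * n + 1) * a ^ 2)
        * (dirDeriv S.ξ f p * dirDeriv S.ξ (dirDeriv S.ξ f) p) := by
  have hK := S.isKenmotsuOn hS p
  have hy : chartAt E p p ∈ (chartAt E p).target := mem_chart_target E p
  have hp : (chartAt E p).symm (chartAt E p p) = p :=
    (chartAt E p).left_inv (mem_chart_source E p)
  have hmd : ∀ x, MDifferentiableAt 𝓘(ℝ, E) 𝓘(ℝ, ℝ) f x := fun x ↦ hf.mdifferentiableAt (by simp)
  have hFon := contDiffOn_comp_symm (x₀ := p) hf.contMDiffOn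
  have hF := hFon.contDiffAt ((chartAt E p).open_target.mem_nhds hy)
  have hVon := contDiffOn_fieldIn_of_contMDiffOn (x₀ := p) hsol.smooth_field.contMDiffOn
  have hV := (hVon.contDiffAt ((chartAt E p).open_target.mem_nhds hy)).differentiableAt (by simp)
  have hξf : Set.EqOn (dirDeriv S.ξ f ∘ (chartAt E p).symm)
      (fun z ↦ fderiv ℝ (f ∘ (chartAt E p).symm) z (fieldIn (chartAt E p) S.ξ z))
      (chartAt E p).target := fun z hz ↦ dirDeriv_eq S.ξ hz (hmd _)
  have hξf_smooth : ContDiffOn ℝ ∞ (dirDeriv S.ξ f ∘ (chartAt E p).symm) (chartAt E p).target :=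
    ((hFon.fderiv_of_isOpen (m := ∞) (chartAt E p).open_target (by simp)).clm_apply
      hK.contDiffOn_field).congr hξf
  have h1 : dirDeriv S.ξ f p = fderiv ℝ (f ∘ (chartAt E p).symm) (chartAt E p p)
      (fieldIn (chartAt E p) S.ξ (chartAt E p p)) := by
    have h := dirDeriv_eq S.ξ hy (hmd _)
    rwa [hp] at h
  have h2 : dirDeriv S.ξ (dirDeriv S.ξ f) p = Coord.hessian (bilinIn (chartAt E p) S.g)
      (f ∘ (chartAt E p).symm) (chartAt E p p) (fieldIn (chartAt E p) S.ξ (chartAt E p p))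
      (fieldIn (chartAt E p) S.ξ (chartAt E p p)) := by
    have h := dirDeriv_eq S.ξ hy (mdifferentiableAt_of_contDiffOn hξf_smooth
      ((chartAt E p).map_target hy))
    rw [hp] at h
    rw [hK.hessian_field_field hy hF, h,
      (hξf.eventuallyEq_of_mem ((chartAt E p).open_target.mem_nhds hy)).fderiv_eq]
  obtain ⟨s, hs⟩ := hK.exists_ricci_eq ha hy hF hV
    (fun z hz ↦ S.deform_fieldIn_grad hS ha hf p hz) (l := lam ((chartAt E p).symm (chartAt E p p)))
    (by
      rw [← S.bilinIn_deformedMetric]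
      exact hsol.equation _ (chart_mem_atlas E p) _ hy)
  have hric := hs (2 * n + 1) _ _ (by rw [hn]; push_cast; ring) rfl h1
  have hunit : bilinIn (chartAt E p) S.g (chartAt E p p) (fieldIn (chartAt E p) S.ξ (chartAt E p p))
      (fieldIn (chartAt E p) S.ξ (chartAt E p p)) = 1 := by
    rw [← hK.form_eq _ hy, hK.form_field _ hy]
  -- The Ricci formula is evaluated at (ξ, ξ) and equated with -2n; this is the relation that
  -- eliminates s.
  have hξξ := hK.ricci_field_field hy
  rw [hric, hn] at hξξ
  simp only [add_apply, smul_apply, smul_eq_mul, ContinuousLinearMap.smulRight_apply, hunit, ← h2]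
    at hξξ
  push_cast at hξξ
  have hN := hilbertSchmidtSq_combination (hK.pos _ hy) (hK.symm _ hy) (hK.hessian_symm hy hF) hunit
  have hT := metricTrace_combination (hK.pos _ hy) (Coord.hessian (bilinIn (chartAt E p) S.g)
      (f ∘ (chartAt E p).symm) (chartAt E p p)) hunit
  have e1 : ricciNormSq S.g p = _ := (congrArg (hilbertSchmidtSq _) hric).trans (hN _ _ _)
  have e2 : scal S.g p = _ := (congrArg (metricTrace _) hric).trans (hT _ _ _)
  rw [← h2, hn] at e1
  rw [hn] at e2
  change ricciNormSq S.g p = _ * hessNormSq S.g f p + _ * laplacian S.g f p + _ + _ + _ + _ at e1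
  change scal S.g p = _ * laplacian S.g f p + _ + _ at e2
  have key := scalar_identity (n := n) (a := a) (H := hessNormSq S.g f p) (D := laplacian S.g f p)
    (h := dirDeriv S.ξ f p) (h' := dirDeriv S.ξ (dirDeriv S.ξ f) p) (s := s) ha.ne' (by positivity)
    rfl rfl (by linear_combination hξξ)
  rw [e1, e2, ge_iff_le, ← sub_nonneg]
  push_cast
  -- The difference of the two sides is the square of tr T divided by 2n+1.
  refine le_of_le_of_eq (b := _) ?_ (key.symm.trans ?_)
  · positivity
  · ring
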